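/- For real $d>0$, $m\in\mathbb{R}$ and $s>0$, the $t$-distribution with $d$ degrees of freedom, location parameter $m$ and scale parameter $s$ is the distribution on $\mathbb{R}$ with Lebesgue density $$x\mapsto \frac{\Gamma\left(\frac{d+1}{2}\right)}{\Gamma\left(\frac d2\right)\sqrt{\pi d}\,s}\left(1+\frac1d\left(\frac{x-m}{s}\right)^2\right)^{-\frac{d+1}{2}},$$ and $t(d)$ denotes the standard $t$-distribution, i.e. the case $m=0$, $s=1$. Let $d>0$ and $v>0$ be real numbers, let $\tau_1\sim t(d)$ and $\tau_2\sim t(d+1)$ be independent random variables, and let $z$ be a random variable (possibly on another probability space) with $$z\stackrel{d}{=}\frac{\tau_1}{\sqrt{vd}}+\sqrt{1+\frac{\tau_1^2}{d}}\;\frac{\tau_2}{\sqrt{d+1}}.$$ Then $z$ follows the $t$-distribution with $d$ degrees of freedom, location parameter $0$ and scale parameter $\sqrt{\frac{v+1}{vd}}$. -/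

import Mathlib

open MeasureTheory ProbabilityTheory

/-- The density at `x` of the univariate Student `t`-distribution with `d` degrees of freedom,
location parameter `m` and scale parameter `s` (where `d > 0` and `s > 0`). -/
noncomputable def studentTPDFReal (d m s x : ℝ) : ℝ :=
  Real.Gamma ((d + 1) / 2) / (Real.Gamma (d / 2) * Real.sqrt (Real.pi * d) * s)
    * (1 + ((x - m) / s) ^ 2 / d) ^ (-((d + 1) / 2))

/-- The univariate Student `t`-distribution with `d` degrees of freedom, location parameter `m`
and scale parameter `s` (where `d > 0` and `s > 0`). -/
noncomputable def studentTMeasure (d m s : ℝ) : Measure ℝ :=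
  volume.withDensity (fun x => ENNReal.ofReal (studentTPDFReal d m s x))

/-- The standard `t`-distribution with `d` degrees of freedom: location zero and scale one. -/
noncomputable def standardTMeasure (d : ℝ) : Measure ℝ :=
  studentTMeasure d 0 1

/-! Conditioning on `τ₁ = x` gives `z` the density obtained by integrating over `x` the `t(d)`
density times a rescaled, shifted `t(d+1)` density. The scale `√(1 + x²/d)` is chosen so that the
two powers merge into one power of `1 + x²/d + (z - x/√(vd))²`. Completing the square in `x` instead
of `z` factors the same expression as the target density at `z` times a `t(d+1)` density in `x`,
rescaled by a factor depending only on `z` (`studentTPDFReal_mul_eq`). The latter integrates to one,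
and the Gamma constants agree without being evaluated. -/

/-- The normalizing constant of the standard `t`-density with `d` degrees of freedom. -/
noncomputable def studentTConst (d : ℝ) : ℝ :=
  Real.Gamma ((d + 1) / 2) / (Real.Gamma (d / 2) * Real.sqrt (Real.pi * d))

lemma studentTConst_nonneg {d : ℝ} (hd : 0 < d) : 0 ≤ studentTConst d := by
  have h1 := Real.Gamma_pos_of_pos (show 0 < (d + 1) / 2 by positivity)
  have h2 := Real.Gamma_pos_of_pos (show 0 < d / 2 by positivity)
  unfold studentTConst
  positivity

lemma studentTPDFReal_eq (d m s x : ℝ) :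
    studentTPDFReal d m s x =
      studentTConst d / s * (1 + ((x - m) / s) ^ 2 / d) ^ (-((d + 1) / 2)) := by
  unfold studentTPDFReal studentTConst
  rw [div_div]

lemma studentTPDFReal_nonneg {d s : ℝ} (hd : 0 < d) (hs : 0 < s) (m x : ℝ) :
    0 ≤ studentTPDFReal d m s x := by
  have := studentTConst_nonneg hd
  rw [studentTPDFReal_eq]
  positivity

@[fun_prop]
lemma measurable_studentTPDFReal (d m s : ℝ) : Measurable (studentTPDFReal d m s) := by
  unfold studentTPDFReal
  fun_prop

lemma lintegral_comp_affine {α : ℝ} (hα : 0 < α) (β : ℝ) {F : ℝ → ENNReal} (hF : Measurable F) :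
    ∫⁻ x, ENNReal.ofReal α * F (α * x + β) = ∫⁻ y, F y := by
  rw [lintegral_const_mul _ (by fun_prop)]
  conv_rhs => rw [← lintegral_add_right_eq_self F β, ← Real.smul_map_volume_mul_left hα.ne']
  rw [lintegral_smul_measure, lintegral_map (by fun_prop) (by fun_prop), abs_of_pos hα, smul_eq_mul]

/-- If `X` and `Y` are independent with densities `p` and `q`, then `a X + b(X) Y` has density
`z ↦ ∫ p(x) q((z - a x) / b(x)) / b(x) dx`. -/
lemma map_affine_prod_withDensity {p q : ℝ → ENNReal} (hp : Measurable p) (hq : Measurable q)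
    [SFinite (volume.withDensity p)] [SFinite (volume.withDensity q)]
    (a : ℝ) {b : ℝ → ℝ} (hb : Measurable b) (hb_pos : ∀ x, 0 < b x) :
    ((volume.withDensity p).prod (volume.withDensity q)).map
        (fun xy : ℝ × ℝ => a * xy.1 + b xy.1 * xy.2) =
      volume.withDensity (fun z =>
        ∫⁻ x, p x * (ENNReal.ofReal (b x)⁻¹ * q ((b x)⁻¹ * z + -(a * x / b x)))) := by
  refine Measure.ext_of_lintegral _ fun f hf => ?_
  have hmeas : Measurable (Function.uncurry fun z x : ℝ =>
      p x * (ENNReal.ofReal (b x)⁻¹ * q ((b x)⁻¹ * z + -(a * x / b x)))) := by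
    unfold Function.uncurry
    fun_prop
  -- For fixed `x`, substitute `y = (z - a x) / b x`; the Jacobian is `(b x)⁻¹`.
  have inner (x : ℝ) : ∫⁻ y, f (a * x + b x * y) ∂(volume.withDensity q) =
      ∫⁻ z, ENNReal.ofReal (b x)⁻¹ * q ((b x)⁻¹ * z + -(a * x / b x)) * f z := by
    rw [lintegral_withDensity_eq_lintegral_mul _ hq (by fun_prop),
      ← lintegral_comp_affine (inv_pos.2 (hb_pos x)) (-(a * x / b x)) (by fun_prop)]
    refine lintegral_congr fun z => ?_
    have hbx := (hb_pos x).ne'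
    have : a * x + b x * ((b x)⁻¹ * z + -(a * x / b x)) = z := by
      field_simp
      ring
    simp only [Pi.mul_apply, this]
    ring
  rw [lintegral_map hf (by fun_prop), lintegral_prod _ (by fun_prop)]
  simp only [inner]
  have hinner : Measurable fun x : ℝ =>
      ∫⁻ z, ENNReal.ofReal (b x)⁻¹ * q ((b x)⁻¹ * z + -(a * x / b x)) * f z := by
    apply Measurable.lintegral_prod_right
    fun_prop
  rw [lintegral_withDensity_eq_lintegral_mul _ hp hinner,
    lintegral_withDensity_eq_lintegral_mul _ hmeas.lintegral_prod_right hf]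
  have hL : ∀ x : ℝ, (p * fun x : ℝ =>
      ∫⁻ z, ENNReal.ofReal (b x)⁻¹ * q ((b x)⁻¹ * z + -(a * x / b x)) * f z) x =
      ∫⁻ z, p x * (ENNReal.ofReal (b x)⁻¹ * q ((b x)⁻¹ * z + -(a * x / b x)) * f z) := by
    intro x
    rw [Pi.mul_apply, lintegral_const_mul _ (by fun_prop)]
  simp only [hL]
  rw [lintegral_lintegral_swap (by unfold Function.uncurry; fun_prop)]
  refine lintegral_congr fun z => ?_
  rw [Pi.mul_apply, ← lintegral_mul_const _ (by fun_prop)]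
  refine lintegral_congr fun x => ?_
  ring

/-- Completing the square in the joint density: as a function of `x` it is the target density at
`z` times a rescaled `t`-density with `d + 1` degrees of freedom. -/
lemma studentTPDFReal_mul_eq {d v : ℝ} (hd : 0 < d) (hv : 0 < v) (x z : ℝ) :
    studentTPDFReal d 0 1 x *
        ((Real.sqrt (1 + x ^ 2 / d) / Real.sqrt (d + 1))⁻¹ *
          studentTPDFReal (d + 1) 0 1
            ((Real.sqrt (1 + x ^ 2 / d) / Real.sqrt (d + 1))⁻¹ * z +
              -((Real.sqrt (v * d))⁻¹ * x / (Real.sqrt (1 + x ^ 2 / d) / Real.sqrt (d + 1))))) =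
      studentTPDFReal d 0 (Real.sqrt ((v + 1) / (v * d))) z *
        (Real.sqrt (d + 1) * Real.sqrt ((v + 1) / (v * d)) /
            Real.sqrt (1 + z ^ 2 * v / (v + 1)) *
          studentTPDFReal (d + 1) 0 1
            (Real.sqrt (d + 1) * Real.sqrt ((v + 1) / (v * d)) /
                Real.sqrt (1 + z ^ 2 * v / (v + 1)) * x +
              -(Real.sqrt (d + 1) * Real.sqrt ((v + 1) / (v * d)) /
                Real.sqrt (1 + z ^ 2 * v / (v + 1)) * (Real.sqrt (v * d) * z / (v + 1))))) := by
  have hB : 0 < 1 + x ^ 2 / d := by positivity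
  have hA : 0 < 1 + z ^ 2 * v / (v + 1) := by positivity
  have hs2 : Real.sqrt ((v + 1) / (v * d)) ^ 2 = (v + 1) / (v * d) := Real.sq_sqrt (by positivity)
  have hr2 : Real.sqrt (v * d) ^ 2 = v * d := Real.sq_sqrt (by positivity)
  have hk2 : Real.sqrt (d + 1) ^ 2 = d + 1 := Real.sq_sqrt (by positivity)
  have hB2 := Real.sq_sqrt hB.le
  have hA2 := Real.sq_sqrt hA.le
  have hs : 0 < Real.sqrt ((v + 1) / (v * d)) := Real.sqrt_pos.2 (by positivity)
  have hr : 0 < Real.sqrt (v * d) := Real.sqrt_pos.2 (by positivity)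
  have hk : 0 < Real.sqrt (d + 1) := Real.sqrt_pos.2 (by positivity)
  have hb : 0 < Real.sqrt (1 + x ^ 2 / d) := Real.sqrt_pos.2 hB
  have ha : 0 < Real.sqrt (1 + z ^ 2 * v / (v + 1)) := Real.sqrt_pos.2 hA
  -- Raises both exponents to that of `t(d+1)`; the spare square root cancels the one in the
  -- Jacobian, on each side.
  have pow_split {t : ℝ} (ht : 0 < t) :
      t ^ (-((d + 1) / 2)) = Real.sqrt t * t ^ (-((d + 1 + 1) / 2)) := by
    rw [Real.sqrt_eq_rpow, ← Real.rpow_add ht]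
    congr 1
    ring
  simp only [studentTPDFReal_eq, sub_zero, div_one]
  generalize Real.sqrt ((v + 1) / (v * d)) = s at *
  generalize Real.sqrt (v * d) = r at *
  generalize Real.sqrt (d + 1) = k at *
  have hzs : (z / s) ^ 2 / d = z ^ 2 * v / (v + 1) := by
    rw [div_pow, hs2]
    field_simp
  rw [hzs, pow_split hA, pow_split hB]
  generalize Real.sqrt (1 + x ^ 2 / d) = b at *
  generalize Real.sqrt (1 + z ^ 2 * v / (v + 1)) = a at *
  have hleft : 1 + ((b / k)⁻¹ * z + -(r⁻¹ * x / (b / k))) ^ 2 / (d + 1) =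
      1 + (z - x / r) ^ 2 / (1 + x ^ 2 / d) := by
    rw [← hB2, ← hk2]
    field_simp
    ring
  have hright : 1 + (k * s / a * x + -(k * s / a * (r * z / (v + 1)))) ^ 2 / (d + 1) =
      1 + (v + 1) / (v * d) * (x - r * z / (v + 1)) ^ 2 / (1 + z ^ 2 * v / (v + 1)) := by
    rw [← hA2, ← hk2, ← hs2]
    field_simp
    ring
  -- Both sides are the same quadratic in `(x, z)`, with the square completed in `z` on the left and
  -- in `x` on the right.
  have hprod : (1 + x ^ 2 / d) * (1 + (z - x / r) ^ 2 / (1 + x ^ 2 / d)) =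
      (1 + z ^ 2 * v / (v + 1)) *
        (1 + (v + 1) / (v * d) * (x - r * z / (v + 1)) ^ 2 / (1 + z ^ 2 * v / (v + 1))) := by
    rw [mul_add, mul_add, mul_div_cancel₀ _ hB.ne', mul_div_cancel₀ _ hA.ne', mul_one, mul_one]
    have h1 : (z - x / r) ^ 2 = z ^ 2 - 2 * z * x * r / (v * d) + x ^ 2 / (v * d) := by
      rw [← hr2]
      field_simp
      ring
    have h2 : (x - r * z / (v + 1)) ^ 2 =
        x ^ 2 - 2 * x * r * z / (v + 1) + v * d * z ^ 2 / (v + 1) ^ 2 := by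
      rw [← hr2]
      field_simp
      ring
    rw [h1, h2]
    field_simp
    ring
  rw [hleft, hright]
  have hpow := congrArg (· ^ (-((d + 1 + 1) / 2))) hprod
  rw [Real.mul_rpow hB.le (by positivity), Real.mul_rpow hA.le (by positivity)] at hpow
  generalize (1 + x ^ 2 / d) ^ (-((d + 1 + 1) / 2)) = X₁ at *
  generalize (1 + (z - x / r) ^ 2 / (1 + x ^ 2 / d)) ^ (-((d + 1 + 1) / 2)) = X₂ at *
  generalize (1 + z ^ 2 * v / (v + 1)) ^ (-((d + 1 + 1) / 2)) = Y₁ at *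
  generalize (1 + (v + 1) / (v * d) * (x - r * z / (v + 1)) ^ 2 / (1 + z ^ 2 * v / (v + 1))) ^
    (-((d + 1 + 1) / 2)) = Y₂ at *
  field_simp
  linear_combination studentTConst d * studentTConst (d + 1) * hpow

theorem lemma1 {Ω Ω' : Type*} [MeasurableSpace Ω] [MeasurableSpace Ω']
    (P : Measure Ω) [IsProbabilityMeasure P] (P' : Measure Ω') [IsProbabilityMeasure P']
    (d v : ℝ) (hd : 0 < d) (hv : 0 < v)
    (τ₁ τ₂ : Ω → ℝ)
    (hτ₁ : HasLaw τ₁ (standardTMeasure d) P)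
    (hτ₂ : HasLaw τ₂ (standardTMeasure (d + 1)) P)
    (hindep : IndepFun τ₁ τ₂ P)
    (z : Ω' → ℝ)
    (hz : IdentDistrib z
      (fun ω => τ₁ ω / Real.sqrt (v * d)
        + Real.sqrt (1 + τ₁ ω ^ 2 / d) * (τ₂ ω / Real.sqrt (d + 1))) P' P) :
    HasLaw z (studentTMeasure d 0 (Real.sqrt ((v + 1) / (v * d)))) P' := by
  refine ⟨hz.aemeasurable_fst, ?_⟩
  have hd1 : 0 < d + 1 := by positivity
  have hs : 0 < Real.sqrt ((v + 1) / (v * d)) := Real.sqrt_pos.2 (by positivity)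
  -- The total mass needs no Beta integral: this density is that of the law of `τ₂` under a
  -- probability measure.
  have mass : ∫⁻ y, ENNReal.ofReal (studentTPDFReal (d + 1) 0 1 y) = 1 := by
    have : IsProbabilityMeasure (standardTMeasure (d + 1)) := by
      rw [← hτ₂.map_eq]
      exact Measure.isProbabilityMeasure_map hτ₂.aemeasurable
    rw [← setLIntegral_univ, ← withDensity_apply _ MeasurableSet.univ]
    exact measure_univ (μ := standardTMeasure (d + 1))
  have hb_pos (x : ℝ) : 0 < Real.sqrt (1 + x ^ 2 / d) / Real.sqrt (d + 1) := by positivity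
  have hmeas : Measurable fun xy : ℝ × ℝ => (Real.sqrt (v * d))⁻¹ * xy.1 +
      Real.sqrt (1 + xy.1 ^ 2 / d) / Real.sqrt (d + 1) * xy.2 := by fun_prop
  have hpair := (indepFun_iff_map_prod_eq_prod_map_map hτ₁.aemeasurable hτ₂.aemeasurable).1 hindep
  rw [hτ₁.map_eq, hτ₂.map_eq] at hpair
  have hfun : (fun ω => τ₁ ω / Real.sqrt (v * d)
        + Real.sqrt (1 + τ₁ ω ^ 2 / d) * (τ₂ ω / Real.sqrt (d + 1))) =
      (fun xy : ℝ × ℝ => (Real.sqrt (v * d))⁻¹ * xy.1 +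
        Real.sqrt (1 + xy.1 ^ 2 / d) / Real.sqrt (d + 1) * xy.2) ∘ fun ω => (τ₁ ω, τ₂ ω) := by
    ext ω
    simp only [Function.comp_apply]
    ring
  rw [hz.map_eq, hfun, ← AEMeasurable.map_map_of_aemeasurable hmeas.aemeasurable
    (hτ₁.aemeasurable.prodMk hτ₂.aemeasurable), hpair]
  unfold standardTMeasure studentTMeasure
  rw [map_affine_prod_withDensity (by fun_prop) (by fun_prop) (Real.sqrt (v * d))⁻¹
    (b := fun x => Real.sqrt (1 + x ^ 2 / d) / Real.sqrt (d + 1)) (by fun_prop) hb_pos]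
  congr 1
  ext z
  have hα : 0 < Real.sqrt (d + 1) * Real.sqrt ((v + 1) / (v * d)) /
      Real.sqrt (1 + z ^ 2 * v / (v + 1)) := by positivity
  calc
    _ = ∫⁻ x, ENNReal.ofReal (studentTPDFReal d 0 (Real.sqrt ((v + 1) / (v * d))) z) *
          (ENNReal.ofReal (Real.sqrt (d + 1) * Real.sqrt ((v + 1) / (v * d)) /
            Real.sqrt (1 + z ^ 2 * v / (v + 1))) * ENNReal.ofReal (studentTPDFReal (d + 1) 0 1
            (Real.sqrt (d + 1) * Real.sqrt ((v + 1) / (v * d)) /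
                Real.sqrt (1 + z ^ 2 * v / (v + 1)) * x +
              -(Real.sqrt (d + 1) * Real.sqrt ((v + 1) / (v * d)) /
                Real.sqrt (1 + z ^ 2 * v / (v + 1)) * (Real.sqrt (v * d) * z / (v + 1)))))) := by
      refine lintegral_congr fun x => ?_
      rw [← ENNReal.ofReal_mul (inv_pos.2 (hb_pos x)).le,
        ← ENNReal.ofReal_mul (studentTPDFReal_nonneg hd one_pos 0 x),
        ← ENNReal.ofReal_mul hα.le, ← ENNReal.ofReal_mul (studentTPDFReal_nonneg hd hs 0 z),
        studentTPDFReal_mul_eq hd hv]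
    _ = _ := by
      rw [lintegral_const_mul _ (by fun_prop), lintegral_comp_affine hα _
        (F := fun y => ENNReal.ofReal (studentTPDFReal (d + 1) 0 1 y)) (by fun_prop), mass, mul_one]
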